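/- Let $K$ be a number field with ring of integers $O_K$, and fix an embedding $\sigma_0:K\to\mathbb C$. A hermitian $O_K$-module is a finitely generated projective $O_K$-module $E$ together with a positive definite hermitian form on $E_\sigma=\mathbb C\otimes_\sigma E$ for every embedding $\sigma:K\to\mathbb C$; write $\|\cdot\|_\sigma$ for the corresponding norm. Duals, tensor products and tensor powers carry the induced metrics. Fix a hermitian $O_K$-module $H$ of rank one, and for a hermitian $O_K$-module $F$ and an integer $x\ge 0$ put $F(x)=F\otimes H^{\otimes x}$. Let $E$ be a hermitian $O_K$-module of rank $m$, let $f\in E_{\sigma_0}$ be a non-zero vector, and let $r_1$ be the dimension of the smallest $K$-subspace $W\subseteq E_K=E\otimes_{O_K}K$ containing $f$, that is, with $f\in W\otimes_{K,\sigma_0}\mathbb C$. For $P\in E^\vee(x)$ denote by $\langle P,f\rangle\in (H^{\otimes x})_{\sigma_0}$ the contraction of $P$ with $f$. We put $\log 0=-\infty$. **Theorem.** Let $c_1,c_2,c_3$ be real constants with $c_2>0$. There are real constants $C_1>0$ and $C_2$, depending only on $c_1,c_2,c_3$ and the degree $[K:\mathbb Q]$ (in particular independent of $m$, $E$, $f$,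 $H$, $b_1$, $b_2$), such that the following holds. Suppose that for some real constants $b_1,b_2$ (which may depend on $m$, $E$, $f$ and $H$, but not on $x$) and for every sufficiently large integer $x$ there exist $O_K$-linearly independent $P_1,\dots,P_m\in E^\vee(x)$ such that, with $F_i=\langle P_i,f\rangle$, for all $i=1,\dots,m$: 1. $\displaystyle\sup_{\sigma:K\to\mathbb C}\log\|P_i\|_\sigma\le c_1\,x\log x+b_1x$; 2. $\displaystyle\log\|F_i\|_{\sigma_0}\le c_1\,x\log x-c_2\,m\,x\log x+c_3\,x\log x+b_2x$. Then $$r_1\ge C_1m+C_2 .$$ -/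

import Mathlib

open scoped TensorProduct ComplexConjugate NumberField

universe u v w

noncomputable section

namespace ArakelovCriterion

/-! ### Two ways of transporting a positive definite hermitian form -/

/-- The restriction of an inner product along an injective linear map. -/
@[reducible]
def coreComap {V W : Type*} [AddCommGroup V] [Module ℂ V]
    [NormedAddCommGroup W] [InnerProductSpace ℂ W] (g : V →ₗ[ℂ] W)
    (hg : Function.Injective g) : InnerProductSpace.Core ℂ V where
  inner a b := inner ℂ (g a) (g b)
  conj_inner_symm a b := inner_conj_symm _ _
  re_inner_nonneg a := inner_self_nonneg
  add_left a b c := by rw [map_add, inner_add_left]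
  smul_left a b r := by rw [map_smul, inner_smul_left]
  definite a h := by
    rw [inner_self_eq_zero] at h
    exact hg (by rw [h, map_zero])

/-- The inner product `⟪a, b⟫ := ⟪g b, g a⟫` obtained from an injective conjugate-linear map `g`. -/
@[reducible]
def coreComapConj {V W : Type*} [AddCommGroup V] [Module ℂ V]
    [NormedAddCommGroup W] [InnerProductSpace ℂ W] (g : V →ₗ⋆[ℂ] W)
    (hg : Function.Injective g) : InnerProductSpace.Core ℂ V where
  inner a b := inner ℂ (g b) (g a)
  conj_inner_symm a b := inner_conj_symm _ _
  re_inner_nonneg a := inner_self_nonneg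
  add_left a b c := by rw [map_add, inner_add_right]
  smul_left a b r := by rw [LinearMap.map_smulₛₗ, inner_smul_right]
  definite a h := by
    rw [inner_self_eq_zero] at h
    exact hg (by rw [h, map_zero])

/-! ### Complexification of an `𝓞 K`-module

First for a given `K`-algebra structure on `ℂ`, then for the one defined by an embedding `σ`. -/

section BaseChange

variable {K : Type u} [Field K] [Algebra K ℂ]
  (M : Type v) [AddCommGroup M] [Module (𝓞 K) M] (N : Type w) [AddCommGroup N] [Module (𝓞 K) N]

variable (K) in
/-- The complex vector space `ℂ ⊗ M`. -/
abbrev BaseChange : Type v := ℂ ⊗[𝓞 K] M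

@[reducible]
def baseChangeAddCommGroup : AddCommGroup (ℂ ⊗[𝓞 K] M) := inferInstance

@[reducible]
def baseChangeModule : Module ℂ (ℂ ⊗[𝓞 K] M) := inferInstance

theorem baseChange_finite [Module.Finite (𝓞 K) M] : Module.Finite ℂ (ℂ ⊗[𝓞 K] M) :=
  inferInstance

variable {M N} in
def baseChangeTmul (z : ℂ) (e : M) : ℂ ⊗[𝓞 K] M := z ⊗ₜ e

variable {M N} in
def baseChangeMap (g : M →ₗ[𝓞 K] N) : (ℂ ⊗[𝓞 K] M) →ₗ[ℂ] (ℂ ⊗[𝓞 K] N) := g.baseChange ℂ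

variable (K) in
/-- The canonical isomorphism `ℂ ⊗ 𝓞 K = ℂ`. -/
def baseChangeUnit : ℂ ⊗[𝓞 K] 𝓞 K ≃ₗ[ℂ] ℂ :=
  TensorProduct.AlgebraTensorModule.rid (𝓞 K) ℂ ℂ

/-- The canonical isomorphism `ℂ ⊗ (M ⊗ N) = (ℂ ⊗ M) ⊗ (ℂ ⊗ N)`. -/
def baseChangeTensor : ℂ ⊗[𝓞 K] (M ⊗[𝓞 K] N) ≃ₗ[ℂ] (ℂ ⊗[𝓞 K] M) ⊗[ℂ] (ℂ ⊗[𝓞 K] N) :=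
  TensorProduct.AlgebraTensorModule.distribBaseChange (𝓞 K) ℂ M N

/-- The canonical map `ℂ ⊗ M^∨ → (ℂ ⊗ M)^∨`, where `M^∨ = Hom(M, 𝓞 K)`. -/
def baseChangeDual :
    ℂ ⊗[𝓞 K] Module.Dual (𝓞 K) M →ₗ[ℂ] Module.Dual ℂ (ℂ ⊗[𝓞 K] M) :=
  LinearMap.liftBaseChange ℂ (Module.Dual.baseChange ℂ)

theorem baseChangeDual_tmul (z a : ℂ) (φ : Module.Dual (𝓞 K) M) (e : M) :
    baseChangeDual M (z ⊗ₜ φ) (a ⊗ₜ e) = z * (a * algebraMap (𝓞 K) ℂ (φ e)) := by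
  simp [baseChangeDual, Algebra.smul_def, mul_comm]

theorem baseChangeDual_injective [Module.Finite (𝓞 K) M] [Module.Projective (𝓞 K) M] :
    Function.Injective (baseChangeDual (K := K) M) := by
  have h : ∀ (t : ℂ ⊗[𝓞 K] Module.Dual (𝓞 K) M) (e : M),
      baseChangeDual M t (1 ⊗ₜ e) =
        dualTensorHom (𝓞 K) M ℂ (TensorProduct.comm (𝓞 K) _ _ t) e := by
    intro t e
    induction t with
    | zero => simp
    | add a b ha hb => simp only [map_add, LinearMap.add_apply, ha, hb]
    | tmul z φ => simp [baseChangeDual_tmul, Algebra.smul_def, mul_comm]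
  intro a b hab
  apply (TensorProduct.comm (𝓞 K) ℂ (Module.Dual (𝓞 K) M)).injective
  apply (dualTensorHom_bijective).injective
  ext e
  rw [← h, ← h, hab]

/-- The canonical map `K ⊗ M → ℂ ⊗ M`. -/
def baseChangeGeneric : K ⊗[𝓞 K] M →ₗ[K] ℂ ⊗[𝓞 K] M :=
  TensorProduct.AlgebraTensorModule.map (Algebra.linearMap K ℂ) LinearMap.id

/-- The coordinate `ℂ ⊗ M → K ⊗ M` attached to a `K`-linear form on `ℂ`. -/
def baseChangeCoord (l : ℂ →ₗ[K] K) : ℂ ⊗[𝓞 K] M →ₗ[K] K ⊗[𝓞 K] M :=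
  TensorProduct.AlgebraTensorModule.map l LinearMap.id

theorem baseChangeCoord_smul_generic (l : ℂ →ₗ[K] K) (z : ℂ) (t : K ⊗[𝓞 K] M) :
    baseChangeCoord M l (z • baseChangeGeneric M t) = l z • t := by
  induction t with
  | zero => simp
  | add a b ha hb => rw [map_add, smul_add, map_add, ha, hb, smul_add]
  | tmul k e =>
    have h : z * algebraMap K ℂ k = k • z := by rw [Algebra.smul_def, mul_comm]
    simp [baseChangeGeneric, baseChangeCoord, TensorProduct.smul_tmul', h, mul_comm]

theorem exists_eq_sum_coord {ι : Type*} (b : Module.Basis ι K ℂ) (f : ℂ ⊗[𝓞 K] M) :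
    ∃ s : Finset ι, ∀ t, s ⊆ t →
      f = ∑ i ∈ t, b i • baseChangeGeneric M (baseChangeCoord M (b.coord i) f) := by
  classical
  induction f with
  | zero => exact ⟨∅, fun t _ => by simp⟩
  | add x y hx hy =>
    obtain ⟨s₁, h₁⟩ := hx
    obtain ⟨s₂, h₂⟩ := hy
    refine ⟨s₁ ∪ s₂, fun t ht => ?_⟩
    have e₁ := h₁ t (Finset.union_subset_left ht)
    have e₂ := h₂ t (Finset.union_subset_right ht)
    simp only [map_add, smul_add, Finset.sum_add_distrib]
    rw [← e₁, ← e₂]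
  | tmul z e =>
    refine ⟨(b.repr z).support, fun t ht => ?_⟩
    have hz : z = ∑ i ∈ t, b i * algebraMap K ℂ (b.coord i z) := by
      conv_lhs => rw [← b.linearCombination_repr z]
      rw [Finsupp.linearCombination_apply, Finsupp.sum_of_support_subset _ ht]
      · simp [Algebra.smul_def, mul_comm]
      · simp
    conv_lhs => rw [hz, TensorProduct.sum_tmul]
    simp [baseChangeGeneric, baseChangeCoord, TensorProduct.smul_tmul']

theorem mem_span_generic_iff {ι : Type*} (b : Module.Basis ι K ℂ) (W : Submodule K (K ⊗[𝓞 K] M))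
    (f : ℂ ⊗[𝓞 K] M) :
    f ∈ Submodule.span ℂ (baseChangeGeneric M '' (W : Set (K ⊗[𝓞 K] M))) ↔
      ∀ i, baseChangeCoord M (b.coord i) f ∈ W := by
  constructor
  · intro hf i
    obtain ⟨n, c, g, rfl⟩ := (Submodule.mem_span_set' (R := ℂ)).1 hf
    rw [map_sum]
    refine Submodule.sum_mem _ fun j _ => ?_
    obtain ⟨w, hw, hwj⟩ := (g j).2
    rw [← hwj, baseChangeCoord_smul_generic]
    exact W.smul_mem _ hw
  · intro h
    obtain ⟨s, hs⟩ := exists_eq_sum_coord M b f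
    rw [hs s subset_rfl]
    exact Submodule.sum_mem _ fun i _ =>
      Submodule.smul_mem _ _ (Submodule.subset_span ⟨_, h i, rfl⟩)

theorem isLeast_sInf_generic (f : ℂ ⊗[𝓞 K] M) :
    IsLeast {W : Submodule K (K ⊗[𝓞 K] M) |
        f ∈ Submodule.span ℂ (baseChangeGeneric M '' (W : Set (K ⊗[𝓞 K] M)))}
      (sInf {W : Submodule K (K ⊗[𝓞 K] M) |
        f ∈ Submodule.span ℂ (baseChangeGeneric M '' (W : Set (K ⊗[𝓞 K] M)))}) := by
  refine ⟨?_, fun W hW => sInf_le hW⟩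
  have b := Module.Basis.ofVectorSpace K ℂ
  simp only [Set.mem_ofPred_eq, mem_span_generic_iff M b, Submodule.mem_sInf]
  exact fun i W hW => hW i

end BaseChange

section Fiber

variable {K : Type u} [Field K]

/-- `ℂ` as a `K`-algebra through `σ`; it is an `𝓞 K`-algebra by restriction. -/
@[reducible]
def algebraVia (σ : K →+* ℂ) : Algebra K ℂ := σ.toAlgebra

variable (σ : K →+* ℂ)

/-- The complex vector space `M_σ = ℂ ⊗ M`, where `ℂ` is an `𝓞 K`-algebra through `σ`. -/
def Fiber (M : Type v) [AddCommGroup M] [Module (𝓞 K) M] : Type v :=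
  @BaseChange K _ (algebraVia σ) M _ _

variable (M : Type v) [AddCommGroup M] [Module (𝓞 K) M] (N : Type w) [AddCommGroup N]
  [Module (𝓞 K) N]

instance : AddCommGroup (Fiber σ M) := @baseChangeAddCommGroup K _ (algebraVia σ) M _ _

instance : Module ℂ (Fiber σ M) := @baseChangeModule K _ (algebraVia σ) M _ _

instance [Module.Finite (𝓞 K) M] : Module.Finite ℂ (Fiber σ M) :=
  @baseChange_finite K _ (algebraVia σ) M _ _ _

variable {M N} in
/-- The element `z ⊗ e` of `M_σ`. -/
def Fiber.tmul (z : ℂ) (e : M) : Fiber σ M :=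
  @baseChangeTmul K _ (algebraVia σ) M _ _ z e

variable {M N} in
/-- The complex linear map `M_σ → N_σ` induced by an `𝓞 K`-linear map `M → N`. -/
def Fiber.map (g : M →ₗ[𝓞 K] N) : Fiber σ M →ₗ[ℂ] Fiber σ N :=
  @baseChangeMap K _ (algebraVia σ) M _ _ N _ _ g

/-- The canonical isomorphism `(𝓞 K)_σ = ℂ`, `z ⊗ a ↦ z σ(a)`. -/
def fiberUnit : Fiber σ (𝓞 K) ≃ₗ[ℂ] ℂ :=
  @baseChangeUnit K _ (algebraVia σ)

/-- The canonical isomorphism `(M ⊗ N)_σ = M_σ ⊗ N_σ`. -/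
def fiberTensor : Fiber σ (M ⊗[𝓞 K] N) ≃ₗ[ℂ] Fiber σ M ⊗[ℂ] Fiber σ N :=
  @baseChangeTensor K _ (algebraVia σ) M _ _ N _ _

/-- The canonical map from `(M^∨)_σ` to the complex dual of `M_σ`, where
`M^∨ = Hom(M, 𝓞 K)`. -/
def fiberDual : Fiber σ (Module.Dual (𝓞 K) M) →ₗ[ℂ] Module.Dual ℂ (Fiber σ M) :=
  @baseChangeDual K _ (algebraVia σ) M _ _

theorem fiberDual_injective [Module.Finite (𝓞 K) M] [Module.Projective (𝓞 K) M] :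
    Function.Injective (fiberDual σ M) :=
  @baseChangeDual_injective K _ (algebraVia σ) M _ _ _ _

/-- The canonical map from `M_K = K ⊗ M` to `M_σ`, `k ⊗ e ↦ σ(k) ⊗ e`. -/
def genericToFiber : K ⊗[𝓞 K] M →+ Fiber σ M :=
  (@baseChangeGeneric K _ (algebraVia σ) M _ _).toAddMonoidHom

end Fiber

/-! ### Hermitian modules over the ring of integers of a number field -/

/-- A hermitian `𝓞 K`-module (hermitian vector bundle over `Spec 𝓞 K`): a finitely generated
projective `𝓞 K`-module `E` with, for every embedding `σ : K → ℂ`, a positive definite hermitian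
form on the complex vector space `E_σ`. -/
structure HermitianModule (K : Type u) [Field K] where
  carrier : Type v
  [addCommGroup : AddCommGroup carrier]
  [module : Module (𝓞 K) carrier]
  [finite : Module.Finite (𝓞 K) carrier]
  [projective : Module.Projective (𝓞 K) carrier]
  core : ∀ σ : K →+* ℂ, InnerProductSpace.Core ℂ (Fiber σ carrier)

namespace HermitianModule

attribute [instance] addCommGroup module finite projective

variable {K : Type u} [Field K]

instance : CoeSort (HermitianModule.{u, v} K) (Type v) := ⟨carrier⟩

instance (E : HermitianModule.{u, v} K) (σ : K →+* ℂ) : NormedAddCommGroup (Fiber σ E) :=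
  (E.core σ).toNormedAddCommGroup

instance (E : HermitianModule.{u, v} K) (σ : K →+* ℂ) : InnerProductSpace ℂ (Fiber σ E) :=
  InnerProductSpace.ofCore (E.core σ).toCore

/-- The rank of `E`. -/
def rank (E : HermitianModule.{u, v} K) : ℕ := Module.finrank (𝓞 K) E

/-- `log ‖z‖_σ` for `z ∈ E_σ`, with the value `-∞` at `z = 0`. -/
def logNorm (E : HermitianModule.{u, v} K) (σ : K →+* ℂ) (z : Fiber σ E) : EReal :=
  ENNReal.log (ENNReal.ofReal ‖z‖)

/-- The trivial hermitian line bundle: `𝓞 K` with `‖1‖_σ = 1` for all `σ`. -/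
def unit (K : Type u) [Field K] : HermitianModule.{u, u} K where
  carrier := 𝓞 K
  core σ := coreComap (fiberUnit σ).toLinearMap (fiberUnit σ).injective

/-- The tensor product `E ⊗ F`; the metric on `(E ⊗ F)_σ = E_σ ⊗ F_σ` is determined by
`⟪a ⊗ b, c ⊗ d⟫ = ⟪a, c⟫ ⟪b, d⟫`. -/
def tensor (E : HermitianModule.{u, v} K) (F : HermitianModule.{u, w} K) :
    HermitianModule.{u, max v w} K where
  carrier := E ⊗[𝓞 K] F
  core σ := coreComap (fiberTensor σ E F).toLinearMap (fiberTensor σ E F).injective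

/-- The tensor power `H^{⊗ n}`. -/
def pow (H : HermitianModule.{u, u} K) : ℕ → HermitianModule.{u, u} K
  | 0 => unit K
  | n + 1 => (pow H n).tensor H

/-- The Riesz representative in `E_σ` of an element of `(E^∨)_σ`, a linear form on `E_σ`. -/
def riesz (E : HermitianModule.{u, v} K) (σ : K →+* ℂ) :
    Fiber σ (Module.Dual (𝓞 K) E) →ₗ⋆[ℂ] Fiber σ E :=
  haveI : CompleteSpace (Fiber σ E) := FiniteDimensional.complete ℂ _
  (InnerProductSpace.toDual ℂ (Fiber σ E)).symm.toLinearEquiv.toLinearMap.comp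
    (LinearMap.toContinuousLinearMap.toLinearMap.comp (fiberDual σ E))

theorem riesz_injective (E : HermitianModule.{u, v} K) (σ : K →+* ℂ) :
    Function.Injective (E.riesz σ) := by
  have : CompleteSpace (Fiber σ E) := FiniteDimensional.complete ℂ _
  exact (InnerProductSpace.toDual ℂ (Fiber σ E)).symm.injective.comp
    (LinearMap.toContinuousLinearMap.injective.comp (fiberDual_injective σ E))

/-- The dual `E^∨ = Hom(E, 𝓞 K)`, with the dual metric on `(E^∨)_σ = Hom(E_σ, ℂ)`. -/
def dual (E : HermitianModule.{u, v} K) : HermitianModule.{u, max u v} K where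
  carrier := Module.Dual (𝓞 K) E
  core σ := coreComapConj (E.riesz σ) (E.riesz_injective σ)

/-- The twist `E(x) = E ⊗ H^{⊗ x}`. -/
def twist (E : HermitianModule.{u, v} K) (H : HermitianModule.{u, u} K) (x : ℕ) :
    HermitianModule.{u, max u v} K :=
  E.tensor (H.pow x)

/-- For `P ∈ E^∨(x)` and `f ∈ E_σ`, the vector `⟨P, f⟩ ∈ (H^{⊗ x})_σ`: the contraction
`E^∨ ⊗ H^{⊗ x} → Hom(E, H^{⊗ x})`, extended to `σ`-fibres and evaluated at `f`. -/
def pairing (E : HermitianModule.{u, v} K) (H : HermitianModule.{u, u} K) (x : ℕ) (σ : K →+* ℂ)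
    (P : E.dual.twist H x) (f : Fiber σ E) : Fiber σ (H.pow x) :=
  Fiber.map σ (dualTensorHom (𝓞 K) E (H.pow x) P) f

/-! ### The smallest `K`-subspace containing a vector of `E_σ` -/

/-- The `K`-vector space `E_K = K ⊗ E`. -/
abbrev Generic (E : HermitianModule.{u, v} K) : Type (max u v) := K ⊗[𝓞 K] E

/-- The complexification `W_σ ⊆ E_σ` of a `K`-subspace `W ⊆ E_K`. -/
def complexify (E : HermitianModule.{u, v} K) (σ : K →+* ℂ) (W : Submodule K E.Generic) :
    Submodule ℂ (Fiber σ E) :=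
  Submodule.span ℂ (genericToFiber σ E '' W)

/-- The smallest `K`-subspace `W` of `E_K` containing `f ∈ E_σ`, i.e. with `f ∈ W_σ`. -/
def minimalSubspace (E : HermitianModule.{u, v} K) (σ : K →+* ℂ) (f : Fiber σ E) :
    Submodule K E.Generic :=
  sInf {W | f ∈ E.complexify σ W}

/-- The subspace `minimalSubspace` is indeed the smallest one. -/
theorem minimalSubspace_isLeast (E : HermitianModule.{u, v} K) (σ : K →+* ℂ) (f : Fiber σ E) :
    IsLeast {W | f ∈ E.complexify σ W} (E.minimalSubspace σ f) :=
  @isLeast_sInf_generic K _ (algebraVia σ) E _ _ f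

end HermitianModule

end ArakelovCriterion

end

/-!
Let `d = [K : ℚ]` and `r = r₁`. Choose `w₁, …, w_r ∈ E` independent and spanning the smallest
subspace, so that `f = ∑ φⱼ (1 ⊗ wⱼ)`, and a linear form `u ≠ 0` on `H`. The `m` independent `Pᵢ`
span a submodule of full rank in `E^∨(x)`, hence `e ↦ (u^{⊗ x}⟨Pᵢ, e⟩)ᵢ` is injective on `E` and the
matrix `u^{⊗ x}⟨Pᵢ, wⱼ⟩` has an `r × r` minor `Δ ≠ 0`. Every conjugate `δ` of `Δ` satisfies
`log |δ| ≤ r c₁ x log x + O(x)`. At `σ₀`, Cramer's rule expresses `Δ φⱼ` by the same minor with a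
column replaced by the small values `u^{⊗ x}(Fᵢ)`, which improves the bound by
`c₂ m x log x - c₃ x log x`. As the norm of the algebraic integer `Δ` is at least `1` in absolute
value, comparing the coefficients of `x log x` gives `c₂ m - c₃ ≤ d r c₁`.
-/

namespace ArakelovCriterion

section LinearAlgebra

variable {R : Type*} [CommRing R] [IsDomain R] {M : Type*} [AddCommGroup M] [Module R M]

theorem finrank_tensorProduct_of_isDomain {N : Type*} [AddCommGroup N] [Module R N] :
    Module.finrank R (M ⊗[R] N) = Module.finrank R M * Module.finrank R N := by
  let F := FractionRing R
  rw [← (TensorProduct.isBaseChange R (M ⊗[R] N) F).finrank_eq,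
    ← (TensorProduct.isBaseChange R M F).finrank_eq,
    ← (TensorProduct.isBaseChange R N F).finrank_eq,
    (TensorProduct.AlgebraTensorModule.distribBaseChange R F M N).finrank_eq,
    Module.finrank_tensorProduct]

theorem eq_zero_of_finrank_le_card [Module.Finite R M] {N : Type*} [AddCommGroup N] [Module R N]
    [Module.IsTorsionFree R N] {ι : Type*} [Fintype ι] {P : ι → M} (hP : LinearIndependent R P)
    (hM : Module.finrank R M ≤ Fintype.card ι) {l : M →ₗ[R] N} (hl : ∀ i, l (P i) = 0) :
    l = 0 := by
  have hspan : Submodule.span R (Set.range P) ≤ LinearMap.ker l :=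
    Submodule.span_le.2 (Set.range_subset_iff.2 hl)
  have hquot : Module.finrank R (M ⧸ Submodule.span R (Set.range P)) = 0 := by
    have := Submodule.finrank_quotient_add_finrank (Submodule.span R (Set.range P))
    rw [finrank_span_eq_card hP] at this
    omega
  ext x
  obtain ⟨a, ha, hax⟩ := Module.finrank_eq_zero_iff.1 hquot (Submodule.Quotient.mk x)
  rw [← Submodule.Quotient.mk_smul, Submodule.Quotient.mk_eq_zero] at hax
  have := hspan hax
  rw [LinearMap.mem_ker, map_smul] at this
  exact (smul_eq_zero.1 this).resolve_left ha

theorem finrank_dual_le [Module.Finite R M] :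
    Module.finrank R (Module.Dual R M) ≤ Module.finrank R M := by
  obtain ⟨P, hP⟩ := exists_linearIndependent_of_le_finrank (le_refl (Module.finrank R M))
  let evalP : Module.Dual R M →ₗ[R] Fin (Module.finrank R M) → R :=
    LinearMap.pi fun i => Module.Dual.eval R M (P i)
  have hinj : Function.Injective evalP := (injective_iff_map_eq_zero _).2 fun φ hφ =>
    eq_zero_of_finrank_le_card hP (Fintype.card_fin _).ge fun i => congrFun hφ i
  simpa using LinearMap.finrank_le_finrank_of_injective hinj

theorem exists_submatrix_det_ne_zero {ι n : Type*} [Finite ι] [Fintype n] [DecidableEq n]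
    {A : Matrix ι n R} (hA : LinearIndependent R A.col) :
    ∃ g : n → ι, (A.submatrix g id).det ≠ 0 := by
  have := Fintype.ofFinite ι
  let F := FractionRing R
  let B : Matrix ι n F := A.map (algebraMap R F)
  have hB : LinearIndependent F B.col := by
    rw [← LinearIndependent.iff_fractionRing R F]
    exact hA.map' ((Algebra.linearMap R F).compLeft ι) (LinearMap.ker_eq_bot.2
      ((FaithfulSMul.algebraMap_injective R F).comp_left))
  obtain ⟨κ, a, ha, hspan, hli⟩ := exists_linearIndependent' F B.row
  have := Fintype.ofInjective a ha
  have hcard : Fintype.card κ = Fintype.card n := by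
    rw [linearIndependent_iff_card_eq_finrank_span.1 hli, Set.finrank, hspan,
      ← B.rank_eq_finrank_span_row, ← B.rank_transpose, LinearIndependent.rank_matrix hB]
  let e := Fintype.equivOfCardEq hcard.symm
  have hunit : IsUnit (B.submatrix (a ∘ e) id) :=
    Matrix.linearIndependent_rows_iff_isUnit.1 (hli.comp e e.injective)
  refine ⟨a ∘ e, fun hdet => ((Matrix.isUnit_iff_isUnit_det _).1 hunit).ne_zero ?_⟩
  rw [Matrix.submatrix_map, ← RingHom.mapMatrix_apply, ← RingHom.map_det, hdet, map_zero]

theorem exists_linearIndependent_span_comp_eq {F V : Type*} [Field F] [Algebra R F]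
    [IsFractionRing R F] [AddCommGroup V] [Module R V] [Module F V] [IsScalarTower R F V]
    [FiniteDimensional F V] (g : M →ₗ[R] V) [IsLocalizedModule (nonZeroDivisors R) g]
    (W : Submodule F V) :
    ∃ w : Fin (Module.finrank F W) → M, LinearIndependent R w ∧
      Submodule.span F (Set.range (g ∘ w)) = W := by
  have hspan : Submodule.span F {v | v ∈ W ∧ v ∈ Set.range g} = W := by
    refine le_antisymm (Submodule.span_le.2 fun v hv => hv.1) fun v hv => ?_
    obtain ⟨⟨e, s⟩, hs⟩ := IsLocalizedModule.surj (nonZeroDivisors R) g v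
    have hs0 : algebraMap R F s ≠ 0 :=
      IsLocalization.to_map_ne_zero_of_mem_nonZeroDivisors F le_rfl s.2
    have hsv : algebraMap R F s • v = g e := (algebraMap_smul F (s : R) v).trans hs
    rw [← Submodule.smul_mem_iff _ hs0]
    exact Submodule.subset_span ⟨W.smul_mem _ hv, e, hsv.symm⟩
  have hbasis := Submodule.exists_fun_fin_finrank_span_eq F {v | v ∈ W ∧ v ∈ Set.range g}
  rw [hspan] at hbasis
  obtain ⟨b, hb, hbspan, hbli⟩ := hbasis
  choose w hw using fun j => (hb j).2
  obtain rfl : g ∘ w = b := funext hw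
  exact ⟨w, .of_comp g ((LinearIndependent.iff_fractionRing R F).2 hbli), hbspan⟩

theorem norm_dualDistrib_tmul_apply_le {𝕜 V W : Type*} [RCLike 𝕜] [NormedAddCommGroup V]
    [InnerProductSpace 𝕜 V] [NormedAddCommGroup W] [InnerProductSpace 𝕜 W] (f : V →L[𝕜] 𝕜)
    (g : W →L[𝕜] 𝕜) (t : V ⊗[𝕜] W) :
    ‖TensorProduct.dualDistrib 𝕜 V W ((f : V →ₗ[𝕜] 𝕜) ⊗ₜ (g : W →ₗ[𝕜] 𝕜)) t‖ ≤
      ‖f‖ * ‖g‖ * ‖t‖ := by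
  have hlid : TensorProduct.dualDistrib 𝕜 V W ((f : V →ₗ[𝕜] 𝕜) ⊗ₜ (g : W →ₗ[𝕜] 𝕜)) t =
      TensorProduct.lid 𝕜 𝕜 (TensorProduct.mapL f g t) := by
    rw [TensorProduct.mapL_apply]
    rfl
  calc _ = ‖TensorProduct.mapL f g t‖ := by rw [hlid, TensorProduct.norm_lid]
    _ ≤ ‖TensorProduct.mapL f g‖ * ‖t‖ := ContinuousLinearMap.le_opNorm _ t
    _ ≤ ‖f‖ * ‖g‖ * ‖t‖ := by gcongr; exact TensorProduct.norm_mapL_le f g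

end LinearAlgebra

section Determinants

variable {n : Type*} [Fintype n] [DecidableEq n] {𝕜 : Type*} [NormedField 𝕜] {A : Matrix n n 𝕜}

theorem norm_det_le {T : ℝ} (hA : ∀ i j, ‖A i j‖ ≤ T) :
    ‖A.det‖ ≤ (Fintype.card n).factorial * T ^ Fintype.card n :=
  (Matrix.det_le (abv := NormedField.toAbsoluteValue 𝕜) hA).trans_eq (nsmul_eq_mul _ _)

-- The factor `T` on the left avoids the exponent `card n - 1` on the right.
theorem mul_norm_det_updateCol_le {b : n → 𝕜} {S T : ℝ} (hA : ∀ i j, ‖A i j‖ ≤ T)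
    (hb : ∀ i, ‖b i‖ ≤ S) (j : n) :
    T * ‖(A.updateCol j b).det‖ ≤ S * ((Fintype.card n).factorial * T ^ Fintype.card n) := by
  have hT : 0 ≤ T := (norm_nonneg _).trans (hA j j)
  have hS : 0 ≤ S := (norm_nonneg _).trans (hb j)
  have hterm (π : Equiv.Perm n) :
      ‖π.sign • ∏ k, A.updateCol j b (π k) k‖ ≤ S * T ^ (Fintype.card n - 1) := by
    have hsign : ‖π.sign • ∏ k, A.updateCol j b (π k) k‖ = ∏ k, ‖A.updateCol j b (π k) k‖ := by
      rcases Int.units_eq_one_or π.sign with h | h <;> simp [h, norm_prod]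
    rw [hsign, ← Finset.mul_prod_erase _ _ (Finset.mem_univ j), Matrix.updateCol_self,
      ← Finset.card_univ, ← Finset.card_erase_of_mem (Finset.mem_univ j)]
    refine mul_le_mul (hb _) ((Finset.prod_le_prod (fun _ _ => norm_nonneg _)
      fun k hk => ?_).trans_eq (Finset.prod_const T)) (by positivity) hS
    rw [Matrix.updateCol_ne (Finset.ne_of_mem_erase hk)]
    exact hA _ _
  have hcard : Fintype.card n - 1 + 1 = Fintype.card n :=
    Nat.sub_add_cancel (Fintype.card_pos_iff.2 ⟨j⟩)
  rw [Matrix.det_apply]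
  calc T * ‖∑ π : Equiv.Perm n, π.sign • ∏ k, A.updateCol j b (π k) k‖
      ≤ T * ∑ _π : Equiv.Perm n, S * T ^ (Fintype.card n - 1) := by
        gcongr
        exact norm_sum_le_of_le _ fun π _ => hterm π
    _ = S * ((Fintype.card n).factorial * T ^ (Fintype.card n - 1 + 1)) := by
        rw [Finset.sum_const, Finset.card_univ, Fintype.card_perm, nsmul_eq_mul]
        ring
    _ = _ := by rw [hcard]

theorem cramer_mulVec {R : Type*} [CommRing R] (A : Matrix n n R) (v : n → R) :
    A.cramer (A.mulVec v) = A.det • v := by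
  rw [Matrix.cramer_eq_adjugate_mulVec, Matrix.mulVec_mulVec, Matrix.adjugate_mul,
    Matrix.smul_mulVec, Matrix.one_mulVec]

end Determinants

section Liouville

variable {K : Type*} [Field K] [NumberField K]

theorem one_le_norm_mul_pow {α : 𝓞 K} (hα : α ≠ 0) (σ : K →+* ℂ) {B : ℝ}
    (hB : ∀ τ : K →+* ℂ, ‖τ α‖ ≤ B) : 1 ≤ ‖σ α‖ * B ^ (Module.finrank ℚ K - 1) := by
  have hnorm : 1 ≤ ‖Algebra.norm ℚ (α : K)‖ := by
    rw [← Algebra.coe_norm_int, ← Rat.norm_cast_real, Rat.cast_intCast, Real.norm_eq_abs,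
      ← Int.cast_abs]
    exact_mod_cast Int.one_le_abs ((Algebra.norm_ne_zero_iff (R := ℤ)).2 hα)
  have hhouse : NumberField.house (α : K) ≤ B :=
    (pi_norm_le_iff_of_nonneg ((norm_nonneg _).trans (hB σ))).2 hB
  calc 1 ≤ ‖Algebra.norm ℚ (α : K)‖ := hnorm
    _ ≤ ‖σ α‖ * NumberField.house (α : K) ^ (Module.finrank ℚ K - 1) :=
        NumberField.norm_norm_le_norm_mul_house_pow _ σ
    _ ≤ ‖σ α‖ * B ^ (Module.finrank ℚ K - 1) := by
        gcongr
        exact NumberField.house_nonneg _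

theorem mul_norm_le_of_det_ne_zero {n : Type*} [Fintype n] [DecidableEq n] {A : Matrix n n (𝓞 K)}
    (hdet : A.det ≠ 0) (σ : K →+* ℂ) {S T : ℝ} (hA : ∀ (τ : K →+* ℂ) i j, ‖τ (A i j)‖ ≤ T)
    {φ : n → ℂ} (hφ : ∀ i, ‖∑ j, σ (A i j) * φ j‖ ≤ S) (j : n) :
    T * ‖φ j‖ ≤ S * ((Fintype.card n).factorial * T ^ Fintype.card n) ^ Module.finrank ℚ K := by
  set N : ℝ := (Fintype.card n).factorial * T ^ Fintype.card n
  let embed (τ : K →+* ℂ) : 𝓞 K →+* ℂ := τ.comp (algebraMap (𝓞 K) K)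
  have hT : 0 ≤ T := (norm_nonneg _).trans (hA σ j j)
  have hcramer : (((embed σ).mapMatrix A).updateCol j ((embed σ).mapMatrix A |>.mulVec φ)).det =
      σ A.det * φ j := by
    rw [← Matrix.cramer_apply, cramer_mulVec, ← RingHom.map_det]
    rfl
  have hupper : T * (‖σ A.det‖ * ‖φ j‖) ≤ S * N := by
    rw [← norm_mul, ← hcramer]
    exact mul_norm_det_updateCol_le (hA σ) hφ j
  have hlower : 1 ≤ ‖σ A.det‖ * N ^ (Module.finrank ℚ K - 1) :=
    one_le_norm_mul_pow hdet σ fun τ =>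
      (congrArg norm ((embed τ).map_det A)).trans_le (norm_det_le (hA τ))
  calc T * ‖φ j‖ ≤ T * ‖φ j‖ * (‖σ A.det‖ * N ^ (Module.finrank ℚ K - 1)) :=
        le_mul_of_one_le_right (by positivity) hlower
    _ = T * (‖σ A.det‖ * ‖φ j‖) * N ^ (Module.finrank ℚ K - 1) := by ring
    _ ≤ S * N * N ^ (Module.finrank ℚ K - 1) := by gcongr
    _ = S * N ^ Module.finrank ℚ K := by
        rw [mul_assoc, mul_pow_sub_one Module.finrank_pos.ne']

end Liouville

section Asymptotics

theorem nonneg_of_frequently_nonneg_mul_log {a b c : ℝ}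
    (h : ∃ᶠ x : ℕ in Filter.atTop, 0 ≤ a * (x * Real.log x) + b * x + c) : 0 ≤ a := by
  by_contra! ha
  have hlim : Filter.Tendsto (fun x : ℕ => a * Real.log x) Filter.atTop Filter.atBot :=
    (Real.tendsto_log_atTop.comp tendsto_natCast_atTop_atTop).const_mul_atTop_of_neg ha
  refine h ?_
  filter_upwards [Filter.eventually_ge_atTop 1, hlim.eventually_lt_atBot (-(b + |c|))]
    with x hx hlog
  have hx : (1 : ℝ) ≤ x := by exact_mod_cast hx
  have hneg : (a * Real.log x + (b + |c|)) * x < 0 :=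
    mul_neg_of_neg_of_pos (by linarith) (by linarith)
  have hc : c ≤ |c| * x := (le_abs_self c).trans (le_mul_of_one_le_right (abs_nonneg c) hx)
  rw [not_le]
  linarith

theorem nonneg_of_frequently_exp_mul_le {d r : ℕ} {p q a b b' t N : ℝ} (ht : 0 < t) (hN : 0 < N)
    (h : ∃ᶠ x : ℕ in Filter.atTop,
      Real.exp (p * (x * Real.log x) + b * x + a) * t ≤
        Real.exp (q * (x * Real.log x) + b' * x) *
          (N * Real.exp (p * (x * Real.log x) + b * x + a) ^ r) ^ d) :
    0 ≤ (d * r - 1) * p + q := by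
  refine nonneg_of_frequently_nonneg_mul_log (b := (d * r - 1) * b + b')
    (c := (d * r - 1) * a + d * Real.log N - Real.log t) (h.mono fun x hx => ?_)
  have hlog := Real.log_le_log (by positivity) hx
  rw [Real.log_mul (by positivity) ht.ne', Real.log_mul (by positivity) (by positivity),
    Real.log_pow, Real.log_mul hN.ne' (by positivity), Real.log_pow] at hlog
  simp only [Real.log_exp] at hlog
  linarith

theorem exists_forall_le_exp {ι : Type*} [Finite ι] (F : ι → ℝ) : ∃ a : ℝ, ∀ i, F i ≤ Real.exp a :=
  (Filter.eventually_all.2 fun i =>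
    Real.tendsto_exp_atTop.eventually_ge_atTop (F i)).exists

theorem exists_affine_lower_bound (d : ℕ) (c₁ c₃ : ℝ) {c₂ : ℝ} (hc₂ : 0 < c₂) :
    ∃ C₁ C₂ : ℝ, 0 < C₁ ∧ ∀ m r : ℕ, c₂ * m - c₃ ≤ d * r * c₁ → C₁ * m + C₂ ≤ r := by
  set M : ℝ := (d + 1) * max c₁ 1
  have hM : 0 < M := by positivity
  refine ⟨c₂ / M, -c₃ / M, by positivity, fun m r h => ?_⟩
  rw [div_mul_eq_mul_div, ← add_div, div_le_iff₀ hM]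
  calc c₂ * m + -c₃ ≤ d * r * c₁ := by linarith
    _ ≤ d * r * max c₁ 1 := by gcongr; exact le_max_left c₁ 1
    _ ≤ (d + 1) * r * max c₁ 1 := by gcongr; linarith
    _ = r * M := by ring

end Asymptotics

section BaseChange

variable {K : Type u} [Field K] [Algebra K ℂ] {M : Type v} [AddCommGroup M] [Module (𝓞 K) M]
  {N : Type w} [AddCommGroup N] [Module (𝓞 K) N]

theorem baseChangeDual_dualDistrib_tmul (α : Module.Dual (𝓞 K) M) (β : Module.Dual (𝓞 K) N) :
    baseChangeDual (M ⊗[𝓞 K] N) (1 ⊗ₜ TensorProduct.dualDistrib (𝓞 K) M N (α ⊗ₜ β)) =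
      TensorProduct.dualDistrib ℂ _ _ (baseChangeDual M (1 ⊗ₜ α) ⊗ₜ baseChangeDual N (1 ⊗ₜ β)) ∘ₗ
        (baseChangeTensor M N).toLinearMap := by
  ext a b
  simp [baseChangeDual_tmul, baseChangeTensor]

theorem baseChangeDual_id :
    baseChangeDual (𝓞 K) (1 ⊗ₜ[𝓞 K] (LinearMap.id : 𝓞 K →ₗ[𝓞 K] 𝓞 K)) =
      (baseChangeUnit K).toLinearMap := by
  ext
  simp [baseChangeDual_tmul, baseChangeUnit]

theorem span_baseChangeGeneric_image_span {ι : Type*} (w : ι → M) :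
    Submodule.span ℂ (baseChangeGeneric M ''
      (Submodule.span K (Set.range (TensorProduct.mk (𝓞 K) K M 1 ∘ w)) : Set (K ⊗[𝓞 K] M))) =
      Submodule.span ℂ (Set.range fun j => (1 : ℂ) ⊗ₜ[𝓞 K] w j) := by
  rw [← Submodule.map_coe, Submodule.map_span, Submodule.span_span_of_tower, ← Set.range_comp]
  congr! with j
  simp [baseChangeGeneric]

end BaseChange

section Fiber

variable {K : Type u} [Field K] (σ : K →+* ℂ) {M : Type v} [AddCommGroup M] [Module (𝓞 K) M]
  {N : Type w} [AddCommGroup N] [Module (𝓞 K) N]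

theorem fiberDual_tmul_tmul (φ : Module.Dual (𝓞 K) M) (z a : ℂ) (e : M) :
    fiberDual σ M (Fiber.tmul σ z φ) (Fiber.tmul σ a e) = z * (a * σ (φ e)) :=
  @baseChangeDual_tmul K _ (algebraVia σ) M _ _ z a φ e

theorem fiberDual_dualDistrib (α : Module.Dual (𝓞 K) M) (β : Module.Dual (𝓞 K) N)
    (t : Fiber σ (M ⊗[𝓞 K] N)) :
    fiberDual σ (M ⊗[𝓞 K] N)
        (Fiber.tmul σ 1 (TensorProduct.dualDistrib (𝓞 K) M N (α ⊗ₜ β))) t =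
      TensorProduct.dualDistrib ℂ _ _
        (fiberDual σ M (Fiber.tmul σ 1 α) ⊗ₜ fiberDual σ N (Fiber.tmul σ 1 β))
        (fiberTensor σ M N t) :=
  LinearMap.congr_fun (@baseChangeDual_dualDistrib_tmul K _ (algebraVia σ) M _ _ N _ _ α β) t

theorem fiberDual_id (z : Fiber σ (𝓞 K)) :
    fiberDual σ (𝓞 K) (Fiber.tmul σ 1 (LinearMap.id : 𝓞 K →ₗ[𝓞 K] 𝓞 K)) z = fiberUnit σ z :=
  LinearMap.congr_fun (@baseChangeDual_id K _ (algebraVia σ)) z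

theorem Fiber.map_tmul (g : M →ₗ[𝓞 K] N) (z : ℂ) (e : M) :
    Fiber.map σ g (Fiber.tmul σ z e) = Fiber.tmul σ z (g e) :=
  rfl

end Fiber

namespace HermitianModule

variable {K : Type u} [Field K] (σ : K →+* ℂ)

theorem norm_tensor (E : HermitianModule.{u, v} K) (F : HermitianModule.{u, w} K)
    (z : Fiber σ (E.tensor F)) : ‖z‖ = ‖fiberTensor σ E F z‖ :=
  (norm_eq_sqrt_re_inner (𝕜 := ℂ) z).trans
    (norm_eq_sqrt_re_inner (𝕜 := ℂ) (fiberTensor σ E F z)).symm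

theorem norm_unit (z : Fiber σ (unit K)) : ‖z‖ = ‖fiberUnit σ z‖ :=
  (norm_eq_sqrt_re_inner (𝕜 := ℂ) z).trans
    (norm_eq_sqrt_re_inner (𝕜 := ℂ) (fiberUnit σ z)).symm

theorem norm_dual (E : HermitianModule.{u, v} K) (ξ : Fiber σ E.dual) :
    ‖ξ‖ = ‖LinearMap.toContinuousLinearMap (fiberDual σ E ξ)‖ := by
  have : CompleteSpace (Fiber σ E) := FiniteDimensional.complete ℂ _
  have hriesz : ‖ξ‖ = ‖E.riesz σ ξ‖ :=
    (norm_eq_sqrt_re_inner (𝕜 := ℂ) ξ).trans (norm_eq_sqrt_re_inner (𝕜 := ℂ) (E.riesz σ ξ)).symm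
  exact hriesz.trans ((InnerProductSpace.toDual ℂ (Fiber σ E)).symm.norm_map _)

variable {σ}

theorem norm_fiberDual_apply_le (E : HermitianModule.{u, v} K) (ξ : Fiber σ E.dual)
    (z : Fiber σ E) : ‖fiberDual σ E ξ z‖ ≤ ‖ξ‖ * ‖z‖ := by
  rw [norm_dual]
  exact (LinearMap.toContinuousLinearMap (fiberDual σ E ξ)).le_opNorm z

theorem norm_dual_le (E : HermitianModule.{u, v} K) {ξ : Fiber σ E.dual} {B : ℝ} (hB : 0 ≤ B)
    (h : ∀ z : Fiber σ E, ‖fiberDual σ E ξ z‖ ≤ B * ‖z‖) : ‖ξ‖ ≤ B := by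
  rw [norm_dual]
  exact ContinuousLinearMap.opNorm_le_bound _ hB h

/-- The norm `‖e‖_σ` of `e ∈ E`, i.e. of its image `1 ⊗ e` in `E_σ`. -/
noncomputable def normAt (E : HermitianModule.{u, v} K) (σ : K →+* ℂ) (e : E) : ℝ :=
  ‖(Fiber.tmul σ 1 e : Fiber σ E)‖

theorem normAt_nonneg (E : HermitianModule.{u, v} K) (e : E) : 0 ≤ E.normAt σ e :=
  norm_nonneg _

theorem norm_apply_le (E : HermitianModule.{u, v} K) (α : Module.Dual (𝓞 K) E) (e : E) :
    ‖σ (α e)‖ ≤ E.dual.normAt σ α * E.normAt σ e := by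
  have hα : σ (α e) = fiberDual σ E (Fiber.tmul σ 1 α) (Fiber.tmul σ 1 e) := by
    rw [fiberDual_tmul_tmul, one_mul, one_mul]
  rw [hα]
  exact E.norm_fiberDual_apply_le _ _

theorem normAt_dualDistrib_le (E : HermitianModule.{u, v} K) (F : HermitianModule.{u, w} K)
    (α : Module.Dual (𝓞 K) E) (β : Module.Dual (𝓞 K) F) :
    (E.tensor F).dual.normAt σ (TensorProduct.dualDistrib (𝓞 K) E F (α ⊗ₜ β)) ≤
      E.dual.normAt σ α * F.dual.normAt σ β := by
  refine norm_dual_le _ (mul_nonneg (normAt_nonneg _ _) (normAt_nonneg _ _)) fun z => ?_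
  unfold normAt
  rw [norm_tensor, norm_dual, norm_dual]
  exact (congrArg norm (fiberDual_dualDistrib σ α β z)).trans_le
    (norm_dualDistrib_tmul_apply_le
      (LinearMap.toContinuousLinearMap (fiberDual σ E (Fiber.tmul σ 1 α)))
      (LinearMap.toContinuousLinearMap (fiberDual σ F (Fiber.tmul σ 1 β))) _)

section Contraction

/-- The linear form `u^{⊗ n}` on `H^{⊗ n}`, for a linear form `u` on `H`. -/
noncomputable def dualPow (H : HermitianModule.{u, u} K) (u : Module.Dual (𝓞 K) H) :
    ∀ n, Module.Dual (𝓞 K) (H.pow n)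
  | 0 => (LinearMap.id : 𝓞 K →ₗ[𝓞 K] 𝓞 K)
  | n + 1 => TensorProduct.dualDistrib (𝓞 K) (H.pow n) H (dualPow H u n ⊗ₜ u)

theorem normAt_dualPow_le (H : HermitianModule.{u, u} K) (u : Module.Dual (𝓞 K) H) (n : ℕ) :
    (H.pow n).dual.normAt σ (H.dualPow u n) ≤ H.dual.normAt σ u ^ n := by
  induction n with
  | zero =>
    refine norm_dual_le _ (by positivity) fun z => ?_
    rw [pow_zero, one_mul]
    exact ((congrArg norm (fiberDual_id σ z)).trans (norm_unit σ z).symm).le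
  | succ n ih =>
    rw [pow_succ]
    exact ((H.pow n).normAt_dualDistrib_le H _ u).trans
      (mul_le_mul_of_nonneg_right ih (normAt_nonneg _ _))

theorem dualPow_ne_zero (H : HermitianModule.{u, u} K) {u : Module.Dual (𝓞 K) H} (hu : u ≠ 0)
    (n : ℕ) : H.dualPow u n ≠ 0 := by
  induction n with
  | zero => exact fun h => one_ne_zero (LinearMap.congr_fun h (1 : 𝓞 K))
  | succ n ih =>
    obtain ⟨h, hh⟩ := DFunLike.ne_iff.1 ih
    obtain ⟨k, hk⟩ := DFunLike.ne_iff.1 hu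
    exact DFunLike.ne_iff.2 ⟨h ⊗ₜ k, mul_ne_zero hh hk⟩

variable (E : HermitianModule.{u, v} K) (H : HermitianModule.{u, u} K)
  (u : Module.Dual (𝓞 K) H) (x : ℕ)

/-- The map sending `e ∈ E` to the linear form `P ↦ u^{⊗ x}⟨P, e⟩` on `E^∨(x)`. -/
noncomputable def contractionForm : E →ₗ[𝓞 K] Module.Dual (𝓞 K) (E.dual.twist H x) :=
  TensorProduct.dualDistrib (𝓞 K) (Module.Dual (𝓞 K) E) (H.pow x) ∘ₗ
    (TensorProduct.mk (𝓞 K) _ _).flip (H.dualPow u x) ∘ₗ Module.Dual.eval (𝓞 K) E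

theorem contractionForm_apply (e : E) (P : E.dual.twist H x) :
    E.contractionForm H u x e P = H.dualPow u x (dualTensorHom (𝓞 K) E (H.pow x) P e) := by
  refine LinearMap.congr_fun (f := E.contractionForm H u x e)
    (g := H.dualPow u x ∘ₗ LinearMap.applyₗ e ∘ₗ dualTensorHom (𝓞 K) E (H.pow x))
    (TensorProduct.ext' fun (φ : Module.Dual (𝓞 K) E) h => ?_) P
  exact (map_smul (H.dualPow u x) (φ e) h).symm

theorem normAt_contractionForm_le (e : E) :
    (E.dual.twist H x).dual.normAt σ (E.contractionForm H u x e) ≤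
      E.dual.dual.normAt σ (Module.Dual.eval (𝓞 K) E e) * H.dual.normAt σ u ^ x :=
  (E.dual.normAt_dualDistrib_le (H.pow x) _ _).trans
    (mul_le_mul_of_nonneg_left (H.normAt_dualPow_le u x) (normAt_nonneg _ _))

variable {u} in
theorem contractionForm_injective (hu : u ≠ 0) :
    Function.Injective (E.contractionForm H u x) := by
  refine (injective_iff_map_eq_zero _).2 fun e h => ?_
  by_contra he
  obtain ⟨φ, hφ⟩ := Module.Projective.exists_dual_ne_zero (𝓞 K) he
  obtain ⟨k, hk⟩ := DFunLike.ne_iff.1 (H.dualPow_ne_zero hu x)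
  exact mul_ne_zero hφ hk (LinearMap.congr_fun h (φ ⊗ₜ[𝓞 K] k))

theorem fiberDual_dualPow_pairing {ι : Type*} [Fintype ι] (w : ι → E) (φ : ι → ℂ)
    (P : E.dual.twist H x) :
    fiberDual σ (H.pow x) (Fiber.tmul σ 1 (H.dualPow u x))
        (E.pairing H x σ P (∑ j, φ j • Fiber.tmul σ 1 (w j))) =
      ∑ j, σ (E.contractionForm H u x (w j) P) * φ j := by
  rw [pairing, map_sum, map_sum]
  refine Finset.sum_congr rfl fun j _ => ?_
  rw [map_smul, map_smul, Fiber.map_tmul, fiberDual_tmul_tmul, one_mul, one_mul,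
    contractionForm_apply, smul_eq_mul, mul_comm]

theorem norm_sum_contractionForm_le {ι : Type*} [Fintype ι] (w : ι → E) (φ : ι → ℂ)
    (P : E.dual.twist H x) :
    ‖∑ j, σ (E.contractionForm H u x (w j) P) * φ j‖ ≤ H.dual.normAt σ u ^ x *
      ‖E.pairing H x σ P (∑ j, φ j • Fiber.tmul σ 1 (w j))‖ := by
  rw [← fiberDual_dualPow_pairing]
  exact ((H.pow x).norm_fiberDual_apply_le _ _).trans
    (mul_le_mul_of_nonneg_right (H.normAt_dualPow_le u x) (norm_nonneg _))

theorem norm_contractionForm_le (e : E) (P : E.dual.twist H x) :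
    ‖σ (E.contractionForm H u x e P)‖ ≤
      E.dual.dual.normAt σ (Module.Dual.eval (𝓞 K) E e) * H.dual.normAt σ u ^ x *
        (E.dual.twist H x).normAt σ P :=
  ((E.dual.twist H x).norm_apply_le _ P).trans
    (mul_le_mul_of_nonneg_right (E.normAt_contractionForm_le H u x e) (normAt_nonneg _ _))

end Contraction

theorem exists_dual_ne_zero {E : HermitianModule.{u, v} K} (hE : 0 < E.rank) :
    ∃ u : Module.Dual (𝓞 K) E, u ≠ 0 := by
  have : Nontrivial E := Module.nontrivial_of_finrank_pos (R := 𝓞 K) hE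
  obtain ⟨h, hh⟩ := exists_ne (0 : E)
  obtain ⟨u, hu⟩ := Module.Projective.exists_dual_ne_zero (𝓞 K) hh
  exact ⟨u, DFunLike.ne_iff.2 ⟨h, hu⟩⟩

theorem rank_tensor (E : HermitianModule.{u, v} K) (F : HermitianModule.{u, w} K) :
    (E.tensor F).rank = E.rank * F.rank :=
  finrank_tensorProduct_of_isDomain (R := 𝓞 K) (M := E) (N := F)

theorem rank_pow (H : HermitianModule.{u, u} K) (n : ℕ) :
    (H.pow n).rank = H.rank ^ n := by
  induction n with
  | zero => exact Module.finrank_self (𝓞 K)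
  | succ n ih => rw [pow_succ, ← ih]; exact rank_tensor _ _

theorem rank_dual_twist_le (E : HermitianModule.{u, v} K) {H : HermitianModule.{u, u} K}
    (hH : H.rank = 1) (x : ℕ) : (E.dual.twist H x).rank ≤ E.rank := by
  rw [twist, rank_tensor, rank_pow, hH, one_pow, mul_one]
  exact finrank_dual_le

theorem exists_det_contractionForm_ne_zero (E : HermitianModule.{u, v} K)
    {H : HermitianModule.{u, u} K} (hH : H.rank = 1) {u : Module.Dual (𝓞 K) H} (hu : u ≠ 0) (x : ℕ)
    {n : Type*} [Fintype n] [DecidableEq n] {w : n → E} (hw : LinearIndependent (𝓞 K) w)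
    {ι : Type*} [Fintype ι] (hι : E.rank ≤ Fintype.card ι)
    {P : ι → E.dual.twist H x} (hP : LinearIndependent (𝓞 K) P) :
    ∃ g : n → ι, (Matrix.of fun i j => E.contractionForm H u x (w j) (P (g i))).det ≠ 0 := by
  let evalP : E →ₗ[𝓞 K] ι → 𝓞 K :=
    LinearMap.pi fun i => Module.Dual.eval (𝓞 K) _ (P i) ∘ₗ E.contractionForm H u x
  have hinj : Function.Injective evalP := (injective_iff_map_eq_zero _).2 fun e he =>
    (injective_iff_map_eq_zero _).1 (E.contractionForm_injective H x hu) e <|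
      eq_zero_of_finrank_le_card hP ((E.rank_dual_twist_le hH x).trans hι) fun i => congrFun he i
  exact exists_submatrix_det_ne_zero (A := .of fun i j => E.contractionForm H u x (w j) (P i))
    (hw.map' evalP (LinearMap.ker_eq_bot.2 hinj))

theorem complexify_span_range (E : HermitianModule.{u, v} K) (σ : K →+* ℂ) {ι : Type*}
    (w : ι → E) :
    E.complexify σ (Submodule.span K (Set.range (TensorProduct.mk (𝓞 K) K E 1 ∘ w))) =
      Submodule.span ℂ (Set.range fun j => (Fiber.tmul σ 1 (w j) : Fiber σ E)) :=
  @span_baseChangeGeneric_image_span K _ (algebraVia σ) E _ _ ι w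

theorem exists_minimalSubspace_coordinates [NumberField K] (E : HermitianModule.{u, v} K)
    (σ : K →+* ℂ) (f : Fiber σ E) :
    ∃ (w : Fin (Module.finrank K (E.minimalSubspace σ f)) → E) (φ : _ → ℂ),
      LinearIndependent (𝓞 K) w ∧ ∑ j, φ j • Fiber.tmul σ 1 (w j) = f := by
  obtain ⟨w, hw, hspan⟩ := exists_linearIndependent_span_comp_eq (R := 𝓞 K)
    (TensorProduct.mk (𝓞 K) K E 1) (E.minimalSubspace σ f)
  have hf : f ∈ E.complexify σ (E.minimalSubspace σ f) := (E.minimalSubspace_isLeast σ f).1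
  rw [← hspan, complexify_span_range, Submodule.mem_span_range_iff_exists_fun] at hf
  obtain ⟨φ, hφ⟩ := hf
  exact ⟨w, φ, hw, hφ⟩

theorem norm_le_exp_of_logNorm_le {E : HermitianModule.{u, v} K} {σ : K →+* ℂ} {z : Fiber σ E}
    {y : ℝ} (h : E.logNorm σ z ≤ y) : ‖z‖ ≤ Real.exp y := by
  rcases (norm_nonneg z).eq_or_lt with hz | hz
  · exact hz ▸ (Real.exp_pos y).le
  · rw [logNorm, ENNReal.log_ofReal_of_pos hz, EReal.coe_le_coe_iff] at h
    exact (Real.log_le_iff_le_exp hz).1 h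

theorem mul_norm_coordinate_le [NumberField K] {E : HermitianModule.{u, v} K}
    {H : HermitianModule.{u, u} K} (hH : H.rank = 1) {u : Module.Dual (𝓞 K) H} (hu : u ≠ 0) {x : ℕ}
    {n : Type*} [Fintype n] {w : n → E} (hw : LinearIndependent (𝓞 K) w)
    {ι : Type*} [Fintype ι] (hι : E.rank ≤ Fintype.card ι) {P : ι → E.dual.twist H x}
    (hP : LinearIndependent (𝓞 K) P) {A B S T : ℝ}
    (hA : ∀ (σ : K →+* ℂ) k, E.dual.dual.normAt σ (Module.Dual.eval (𝓞 K) E (w k)) ≤ A)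
    (hB : ∀ σ : K →+* ℂ, H.dual.normAt σ u ≤ B)
    (hT : ∀ (σ : K →+* ℂ) i, (E.dual.twist H x).normAt σ (P i) ≤ T)
    {σ₀ : K →+* ℂ} {φ : n → ℂ}
    (hS : ∀ i, ‖E.pairing H x σ₀ (P i) (∑ k, φ k • Fiber.tmul σ₀ 1 (w k))‖ ≤ S) (j : n) :
    A * B ^ x * T * ‖φ j‖ ≤ B ^ x * S *
      ((Fintype.card n).factorial * (A * B ^ x * T) ^ Fintype.card n) ^ Module.finrank ℚ K := by
  classical
  obtain ⟨g, hg⟩ := E.exists_det_contractionForm_ne_zero hH hu x hw hι hP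
  have hB₀ : 0 ≤ B := (normAt_nonneg _ _).trans (hB σ₀)
  have hA₀ : 0 ≤ A := (normAt_nonneg _ _).trans (hA σ₀ j)
  have hpow (σ : K →+* ℂ) : H.dual.normAt σ u ^ x ≤ B ^ x :=
    pow_le_pow_left₀ (normAt_nonneg _ _) (hB σ) x
  refine mul_norm_le_of_det_ne_zero hg σ₀ (fun σ i k => ?_) (fun i => ?_) j
  · refine (E.norm_contractionForm_le H u x (w k) (P (g i))).trans ?_
    exact mul_le_mul (mul_le_mul (hA σ k) (hpow σ) (pow_nonneg (normAt_nonneg _ _) x) hA₀)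
      (hT σ (g i)) (normAt_nonneg _ _) (by positivity)
  · refine (E.norm_sum_contractionForm_le H u x w φ (P (g i))).trans ?_
    exact mul_le_mul (hpow σ₀) (hS (g i)) (norm_nonneg _) (by positivity)

theorem nonneg_of_frequently_exists_norm_pairing_le [NumberField K] {E : HermitianModule.{u, v} K}
    {H : HermitianModule.{u, u} K} (hH : H.rank = 1) {σ₀ : K →+* ℂ} {f : Fiber σ₀ E} (hf : f ≠ 0)
    {p q b₁ b₂ : ℝ}
    (h : ∃ᶠ x : ℕ in Filter.atTop, ∃ P : Fin E.rank → E.dual.twist H x,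
      LinearIndependent (𝓞 K) P ∧
      (∀ i σ, (E.dual.twist H x).normAt σ (P i) ≤ Real.exp (p * (x * Real.log x) + b₁ * x)) ∧
      ∀ i, ‖E.pairing H x σ₀ (P i) f‖ ≤ Real.exp (q * (x * Real.log x) + b₂ * x)) :
    0 ≤ (Module.finrank ℚ K * Module.finrank K (E.minimalSubspace σ₀ f) - 1) * p + q := by
  obtain ⟨w, φ, hw, hfφ⟩ := E.exists_minimalSubspace_coordinates σ₀ f
  obtain ⟨j, hj⟩ : ∃ j, φ j ≠ 0 := by
    by_contra! hφ
    exact hf (by simp [← hfφ, hφ])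
  obtain ⟨u, hu⟩ := exists_dual_ne_zero (hH.symm ▸ one_pos : 0 < H.rank)
  obtain ⟨β, hβ⟩ := exists_forall_le_exp fun σ : K →+* ℂ => H.dual.normAt σ u
  obtain ⟨a, ha⟩ := exists_forall_le_exp fun t : (K →+* ℂ) × Fin _ =>
    E.dual.dual.normAt t.1 (Module.Dual.eval (𝓞 K) E (w t.2))
  refine nonneg_of_frequently_exp_mul_le (a := a) (b := b₁ + β) (b' := b₂ + β)
    (N := (Module.finrank K (E.minimalSubspace σ₀ f)).factorial) (norm_pos_iff.2 hj)
    (by positivity) (h.mono ?_)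
  rintro x ⟨P, hP, hP₁, hP₂⟩
  have hcoord := mul_norm_coordinate_le hH hu hw (Fintype.card_fin _).ge hP
    (fun σ k => ha (σ, k)) hβ (fun σ i => hP₁ i σ) (by rwa [hfφ]) j
  have hentry : Real.exp a * Real.exp β ^ x * Real.exp (p * (x * Real.log x) + b₁ * x) =
      Real.exp (p * (x * Real.log x) + (b₁ + β) * x + a) := by
    rw [← Real.exp_nat_mul, ← Real.exp_add, ← Real.exp_add]
    ring_nf
  have hvalue : Real.exp β ^ x * Real.exp (q * (x * Real.log x) + b₂ * x) =
      Real.exp (q * (x * Real.log x) + (b₂ + β) * x) := by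
    rw [← Real.exp_nat_mul, ← Real.exp_add]
    ring_nf
  rwa [hentry, hvalue, Fintype.card_fin] at hcoord

end HermitianModule

end ArakelovCriterion

open ArakelovCriterion in
theorem mainTheorem6_general {K : Type u} [Field K] [NumberField K] {σ₀ : K →+* ℂ}
    {H : HermitianModule.{u, u} K} (hH : H.rank = 1) {E : HermitianModule.{u, v} K}
    {f : Fiber σ₀ E} (hf : f ≠ 0) {c₁ c₂ c₃ b₁ b₂ : ℝ}
    (h : ∃ᶠ x : ℕ in Filter.atTop, ∃ P : Fin E.rank → E.dual.twist H x,
      LinearIndependent (𝓞 K) P ∧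
      (∀ i, (⨆ σ : K →+* ℂ, (E.dual.twist H x).logNorm σ (Fiber.tmul σ 1 (P i))) ≤
        ((c₁ * x * Real.log x + b₁ * x : ℝ) : EReal)) ∧
      (∀ i, (H.pow x).logNorm σ₀ (E.pairing H x σ₀ (P i) f) ≤
        ((c₁ * x * Real.log x - c₂ * E.rank * x * Real.log x + c₃ * x * Real.log x + b₂ * x : ℝ) :
          EReal))) :
    c₂ * E.rank - c₃ ≤
      Module.finrank ℚ K * Module.finrank K (E.minimalSubspace σ₀ f) * c₁ := by
  have hdegree := HermitianModule.nonneg_of_frequently_exists_norm_pairing_le (p := c₁)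
    (q := c₁ - c₂ * E.rank + c₃) (b₁ := b₁) (b₂ := b₂) hH hf <| h.mono fun x ⟨P, hP, hP₁, hP₂⟩ =>
      ⟨P, hP, fun i σ => ?_, fun i => ?_⟩
  · linarith
  · rw [← mul_assoc]
    exact HermitianModule.norm_le_exp_of_logNorm_le ((le_iSup (fun σ : K →+* ℂ =>
      (E.dual.twist H x).logNorm σ (Fiber.tmul σ 1 (P i))) σ).trans (hP₁ i))
  · convert HermitianModule.norm_le_exp_of_logNorm_le (hP₂ i) using 2
    ring

theorem mainTheorem6 (d : ℕ) (c₁ c₂ c₃ : ℝ) (hc₂ : 0 < c₂) :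
    ∃ C₁ C₂ : ℝ, 0 < C₁ ∧
      ∀ (K : Type u) [Field K] [NumberField K], Module.finrank ℚ K = d →
      ∀ (σ₀ : K →+* ℂ) (H : ArakelovCriterion.HermitianModule.{u, u} K), H.rank = 1 →
      ∀ (m : ℕ) (E : ArakelovCriterion.HermitianModule.{u, v} K), E.rank = m →
      ∀ (f : ArakelovCriterion.Fiber σ₀ E), f ≠ 0 →
      ∀ (b₁ b₂ : ℝ),
        (∀ᶠ x : ℕ in Filter.atTop, ∃ P : Fin m → E.dual.twist H x,
          LinearIndependent (NumberField.RingOfIntegers K) P ∧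
          (∀ i, (⨆ σ : K →+* ℂ,
              (E.dual.twist H x).logNorm σ (ArakelovCriterion.Fiber.tmul σ 1 (P i))) ≤
            ((c₁ * x * Real.log x + b₁ * x : ℝ) : EReal)) ∧
          (∀ i, (H.pow x).logNorm σ₀ (E.pairing H x σ₀ (P i) f) ≤
            ((c₁ * x * Real.log x - c₂ * m * x * Real.log x + c₃ * x * Real.log x + b₂ * x : ℝ) :
              EReal))) →
        C₁ * m + C₂ ≤ (Module.finrank K (E.minimalSubspace σ₀ f) : ℝ) := by
  obtain ⟨C₁, C₂, hC₁, hbound⟩ := ArakelovCriterion.exists_affine_lower_bound d c₁ c₃ hc₂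
  refine ⟨C₁, C₂, hC₁, ?_⟩
  rintro K _ _ rfl σ₀ H hH m E rfl f hf b₁ b₂ h
  exact hbound _ _ (mainTheorem6_general hH hf h.frequently)
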